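/- Let $\mathcal A$ be a unital $C^*$-algebra. For Hilbert $\mathcal A$-modules $M,N$ let $B^a(M,N)$ be the set of bounded adjointable $\mathcal A$-linear operators $M\to N$. Consider decompositions $M=M_1\tilde\oplus N_1$, $N=M_2\tilde\oplus N_2$ into topological (not necessarily orthogonal) direct sums of closed submodules with respect to which $F\in B^a(M,N)$ has the matrix $\begin{pmatrix}F_1&0\\0&F_4\end{pmatrix}$, where $F_1:M_1\to M_2$ is an isomorphism. Write $F\in\mathcal M\Phi_+(M,N)$ if there is such a decomposition with $N_1$ finitely generated, $F\in\mathcal M\Phi_-(M,N)$ if there is one with $N_2$ finitely generated, and call $F$ $\mathcal A$-Fredholm, $F\in\mathcal M\Phi(M,N)$, if there is one with both $N_1$ and $N_2$ finitely generated (an $\mathcal M\Phi$-decomposition). Let $H_{\mathcal A}=\ell^2(\mathcal A)$ be the standard Hilbert $\mathcal A$-module and $\mathcal M\Phi(H_{\mathcal A})=\mathcal M\Phi(H_{\mathcal A},H_{\mathcal A})$. For $F\in\mathcal M\Phi(H_{\mathcal A})$ put $\operatorname{index}F=[N_1]-[N_2]\in K(\mathcal A)$ for an $\mathcal M\Phi$-decomposition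 of $F$, where $K(\mathcal A)=K_0(\mathcal A)$ is the Grothendieck group of the monoid of isomorphism classes of finitely generated projective $\mathcal A$-modules. 1. Let $M,N$ be Hilbert $\mathcal A$-modules and $F\in B^a(M,N)$. Then $F\in\mathcal M\Phi_+(M,N)$ if and only if $F^*\in\mathcal M\Phi_-(N,M)$. 2. If $F\in\mathcal M\Phi(H_{\mathcal A})$, then $F^*\in\mathcal M\Phi(H_{\mathcal A})$, the elements $\operatorname{index}F$ and $\operatorname{index}F^*$ of $K(\mathcal A)$ do not depend on the choice of the $\mathcal M\Phi$-decompositions of $F$ and of $F^*$, and $\operatorname{index}F=-\operatorname{index}F^*$. -/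

import Mathlib

universe u v w

namespace HilbertMod

open CStarModule
open scoped WithCStarModule

section basic
set_option linter.unusedSectionVars false
variable {A : Type u} [CStarAlgebra A] [PartialOrder A] [StarOrderedRing A]
variable {E : Type v} [NormedAddCommGroup E] [NormedSpace ℂ E] [Module A E] [CStarModule A E]

variable (A) in
/-- Two vectors with the same inner products against everything are equal. -/
theorem ext_inner {x y : E} (h : ∀ z : E, inner A z x = inner A z y) : x = y := by
  rw [← sub_eq_zero, ← CStarModule.inner_self (A := A)]
  rw [CStarModule.inner_sub_right, h, sub_self]

variable (A E) in
/-- In a Hilbert module the complex scalars act through the algebra. -/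
theorem isScalarTower : IsScalarTower ℂ A E :=
  ⟨fun z a x => ext_inner A fun y => by simp⟩

theorem norm_smul_le' (a : A) (x : E) : ‖a • x‖ ≤ ‖a‖ * ‖x‖ := by
  refine abs_le_of_sq_le_sq' ?_ (by positivity) |>.2
  rw [CStarModule.norm_sq_eq A, mul_pow, CStarModule.norm_sq_eq A (E := E)]
  simp only [inner_op_smul_right, inner_op_smul_left]
  calc ‖a * (inner A x x * star a)‖ ≤ ‖a‖ * (‖inner A x x‖ * ‖star a‖) :=
        (norm_mul_le _ _).trans (by gcongr; exact norm_mul_le _ _)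
    _ = _ := by rw [norm_star]; ring

/-- A self-map that is bounded below along the whole ray `S + t`, `t ≥ 0`, is invertible. -/
theorem isUnit_of_bddBelow {E : Type v} [NormedAddCommGroup E] [NormedSpace ℂ E] [CompleteSpace E]
    (S : E →L[ℂ] E) {c : ℝ} (hc : 0 < c)
    (h : ∀ t : ℝ, 0 ≤ t → ∀ y : E, c * ‖y‖ ≤ ‖S y + t • y‖) : IsUnit S := by
  have key : ∀ t s : ℝ, 0 ≤ t → |s - t| ≤ c / 2 → IsUnit (S + t • (1 : E →L[ℂ] E)) →
      IsUnit (S + s • (1 : E →L[ℂ] E)) := by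
    rintro t s ht hst ⟨u, hu⟩
    have hinv : ‖(↑u⁻¹ : E →L[ℂ] E)‖ ≤ c⁻¹ := by
      refine ContinuousLinearMap.opNorm_le_bound _ (by positivity) fun y => ?_
      have h1 := h t ht ((↑u⁻¹ : E →L[ℂ] E) y)
      have h2 : S ((↑u⁻¹ : E →L[ℂ] E) y) + t • ((↑u⁻¹ : E →L[ℂ] E) y) = y := by
        have := congrArg (fun T : E →L[ℂ] E => T y) u.mul_inv
        rw [hu] at this
        simpa using this
      rw [h2] at h1
      rw [inv_mul_eq_div, le_div_iff₀ hc, mul_comm]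
      exact h1
    have e : S + s • (1 : E →L[ℂ] E) = u * (1 - (↑u⁻¹ : E →L[ℂ] E) * ((t - s) • 1)) := by
      rw [mul_sub, mul_one, ← mul_assoc, Units.mul_inv, one_mul, hu, sub_smul]
      abel
    rw [e]
    refine u.isUnit.mul (isUnit_one_sub_of_norm_lt_one ?_)
    calc ‖(↑u⁻¹ : E →L[ℂ] E) * ((t - s) • 1)‖ ≤ c⁻¹ * (c / 2 * 1) := by
          refine (norm_mul_le _ _).trans ?_
          gcongr
          rw [norm_smul]
          gcongr
          · rw [Real.norm_eq_abs, abs_sub_comm]; exact hst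
          · exact ContinuousLinearMap.norm_id_le
      _ < 1 := by field_simp; norm_num
  have start : IsUnit (S + (2 * ‖S‖ + 1) • (1 : E →L[ℂ] E)) := by
    have hp : (0 : ℝ) < 2 * ‖S‖ + 1 := by positivity
    have e : S + (2 * ‖S‖ + 1) • (1 : E →L[ℂ] E) =
        ((2 * ‖S‖ + 1) • (1 : E →L[ℂ] E)) * (1 - (-(2 * ‖S‖ + 1)⁻¹) • S) := by
      ext y
      simp only [_root_.add_apply, _root_.smul_apply,
        mul_apply_eq_comp,
        one_apply_eq_self, neg_smul, sub_neg_eq_add, smul_add, smul_smul]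
      rw [mul_inv_cancel₀ hp.ne', one_smul, add_comm]
    rw [e]
    refine IsUnit.mul ?_ (isUnit_one_sub_of_norm_lt_one ?_)
    · exact (isUnit_one (M := E →L[ℂ] E)).smul (Units.mk0 _ hp.ne')
    · rw [norm_smul, norm_neg, norm_inv, Real.norm_of_nonneg hp.le, inv_mul_lt_iff₀ hp]
      linarith [norm_nonneg S]
  have all : ∀ n : ℕ,
      IsUnit (S + (max 0 (2 * ‖S‖ + 1 - n * (c / 2))) • (1 : E →L[ℂ] E)) := by
    intro n
    induction n with
    | zero =>
      have : max 0 (2 * ‖S‖ + 1 - ((0 : ℕ) : ℝ) * (c / 2)) = 2 * ‖S‖ + 1 := by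
        rw [max_eq_right] <;> simp; positivity
      rw [this]; exact start
    | succ n ih =>
      refine key _ _ (le_max_left _ _) ?_ ih
      refine (abs_max_sub_max_le_max _ _ _ _).trans ?_
      rw [sub_self, abs_zero]
      refine max_le (by positivity) ?_
      rw [abs_sub_comm, abs_of_nonneg] <;> push_cast <;> linarith
  obtain ⟨n, hn⟩ := exists_nat_gt ((2 * ‖S‖ + 1) / (c / 2))
  rw [div_lt_iff₀ (by positivity)] at hn
  have := all n
  rwa [max_eq_left (by linarith), zero_smul, add_zero] at this

/-- A finitely generated Hilbert module over a unital C⋆-algebra is projective. -/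
theorem projective_of_finite [CompleteSpace E] [Module.Finite A E] : Module.Projective A E := by
  have := isScalarTower A E
  obtain ⟨n, x, hx⟩ := Module.Finite.exists_fin (R := A) (M := E)
  -- the frame operator `y ↦ ∑ ⟪x i, y⟫ • x i`
  let T : C⋆ᵐᵒᵈ(A, Fin n → A) →ₗ[A] E :=
    { toFun := fun a => ∑ i, a i • x i
      map_add' := fun a b => by simp [add_smul, Finset.sum_add_distrib]
      map_smul' := fun r a => by
        rw [RingHom.id_apply, Finset.smul_sum]
        exact Finset.sum_congr rfl fun i _ => by rw [← mul_smul]; rfl }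
  let B : E →ₗ[A] C⋆ᵐᵒᵈ(A, Fin n → A) :=
    { toFun := fun y => (WithCStarModule.equiv A (Fin n → A)).symm fun i => inner A (x i) y
      map_add' := fun a b => by ext i; exact CStarModule.inner_add_right
      map_smul' := fun r a => by ext i; exact CStarModule.inner_op_smul_right }
  have hTB : ∀ (a : C⋆ᵐᵒᵈ(A, Fin n → A)) (y : E), inner A y (T a) = inner A (B y) a := by
    intro a y
    rw [WithCStarModule.pi_inner]
    change inner A y (∑ i, a i • x i) = ∑ i, a i * star (inner A (x i) y)
    simp
  have hTsurj : Function.Surjective T := by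
    intro y
    have : y ∈ Submodule.span A (Set.range x) := by rw [hx]; trivial
    obtain ⟨a, ha⟩ := (Submodule.mem_span_range_iff_exists_fun A).1 this
    exact ⟨(WithCStarModule.equiv A (Fin n → A)).symm a, by simpa [T] using ha⟩
  let Tc : C⋆ᵐᵒᵈ(A, Fin n → A) →L[ℂ] E := (T.restrictScalars ℂ).mkContinuous (∑ i, ‖x i‖) fun a => by
    rw [Finset.sum_mul]
    change ‖∑ i, a i • x i‖ ≤ _
    refine (norm_sum_le _ _).trans (Finset.sum_le_sum fun i _ => ?_)
    rw [mul_comm]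
    exact (norm_smul_le' _ _).trans
      (by gcongr; exact WithCStarModule.norm_apply_le_norm a i)
  let Bc : E →L[ℂ] C⋆ᵐᵒᵈ(A, Fin n → A) := (B.restrictScalars ℂ).mkContinuous (∑ i, ‖x i‖) fun y => by
    rw [Finset.sum_mul]
    refine (WithCStarModule.pi_norm_le_sum_norm _).trans (Finset.sum_le_sum fun i _ => ?_)
    exact norm_inner_le E
  obtain ⟨C, hC, hpre⟩ := Tc.exists_preimage_norm_le hTsurj
  have hlow : ∀ y : E, ‖y‖ ≤ C * ‖B y‖ := by
    intro y
    obtain ⟨a, ha, han⟩ := hpre y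
    rcases eq_or_ne y 0 with rfl | hy
    · simp
    have h1 : ‖y‖ ^ 2 ≤ ‖B y‖ * (C * ‖y‖) := by
      calc ‖y‖ ^ 2 = ‖inner A y (T a)‖ := by
            rw [CStarModule.norm_sq_eq A]; congr 2; exact ha.symm
        _ = ‖inner A (B y) a‖ := by rw [hTB]
        _ ≤ ‖B y‖ * ‖a‖ := norm_inner_le C⋆ᵐᵒᵈ(A, Fin n → A)
        _ ≤ _ := by gcongr
    have hy' : 0 < ‖y‖ := norm_pos_iff.2 hy
    nlinarith
  have hunit : IsUnit (Tc ∘L Bc) := by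
    refine isUnit_of_bddBelow (c := (C ^ 2)⁻¹) _ (by positivity) fun t ht y => ?_
    rcases eq_or_ne y 0 with rfl | hy
    · simp
    have hy' : 0 < ‖y‖ := norm_pos_iff.2 hy
    have h1 : ‖inner A (B y) (B y)‖ ≤ ‖y‖ * ‖T (B y) + t • y‖ := by
      calc ‖inner A (B y) (B y)‖ ≤ ‖inner A y (T (B y) + t • y)‖ := by
            refine CStarAlgebra.norm_le_norm_of_nonneg_of_le inner_self_nonneg ?_
            rw [CStarModule.inner_add_right, hTB, CStarModule.inner_smul_right_real]
            exact le_add_of_nonneg_right (smul_nonneg ht inner_self_nonneg)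
        _ ≤ _ := norm_inner_le E
    rw [← CStarModule.norm_sq_eq A] at h1
    have h2 := hlow y
    have h3 : ‖y‖ ^ 2 ≤ C ^ 2 * (‖y‖ * ‖T (B y) + t • y‖) := by
      calc ‖y‖ ^ 2 ≤ (C * ‖B y‖) ^ 2 := by gcongr
        _ = C ^ 2 * ‖B y‖ ^ 2 := by ring
        _ ≤ _ := by gcongr
    change (C ^ 2)⁻¹ * ‖y‖ ≤ ‖T (B y) + t • y‖
    rw [inv_mul_le_iff₀ (by positivity)]
    nlinarith
  have hbij : Function.Bijective (T ∘ₗ B) := by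
    obtain ⟨u, hu⟩ := hunit
    have h := (ContinuousLinearEquiv.unitsEquiv ℂ E u).bijective
    have e : ∀ y, ContinuousLinearEquiv.unitsEquiv ℂ E u y = (T ∘ₗ B) y := fun y => by
      rw [ContinuousLinearEquiv.unitsEquiv_apply, hu]; rfl
    rwa [show (⇑(ContinuousLinearEquiv.unitsEquiv ℂ E u)) = ⇑(T ∘ₗ B) from funext e] at h
  let e := LinearEquiv.ofBijective (T ∘ₗ B) hbij
  have : Module.Projective A C⋆ᵐᵒᵈ(A, Fin n → A) := inferInstanceAs (Module.Projective A (Fin n → A))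
  refine Module.Projective.of_split (B ∘ₗ e.symm.toLinearMap) T ?_
  ext y
  exact e.apply_symm_apply y

/-- A finitely generated closed submodule of a Hilbert module is projective. -/
theorem projective_submodule [CompleteSpace E] (N : Submodule A E) (hcl : IsClosed (N : Set E))
    (hfg : N.FG) : Module.Projective A N := by
  have := isScalarTower A E
  have : CompleteSpace N := hcl.completeSpace_coe
  have : Module.Finite A N := Module.Finite.of_fg hfg
  let : CStarModule A N :=
    { inner := fun x y => inner A (x : E) (y : E)
      inner_add_right := by simp
      inner_self_nonneg := CStarModule.inner_self_nonneg
      inner_self := by intro x; rw [CStarModule.inner_self]; simp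
      inner_op_smul_right := by simp
      inner_smul_right_complex := by simp
      star_inner := by simp
      norm_eq_sqrt_norm_inner_self := fun x =>
        CStarModule.norm_eq_sqrt_norm_inner_self (A := A) (x : E) }
  exact projective_of_finite
end basic

section StandardModule
variable (A : Type u) [CStarAlgebra A]

/-- The norm of the restriction of a sequence to a finite set of indices. -/
noncomputable def finNorm {A : Type u} [CStarAlgebra A] (s : Finset ℕ) (x : ℕ → A) : ℝ :=
  √‖∑ i ∈ s, x i * star (x i)‖

theorem finNorm_sq {A : Type u} [CStarAlgebra A] (s : Finset ℕ) (x : ℕ → A) :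
    finNorm s x ^ 2 = ‖∑ i ∈ s, x i * star (x i)‖ := Real.sq_sqrt (norm_nonneg _)

section order
variable {A} [PartialOrder A] [StarOrderedRing A]

theorem finNorm_eq (s : Finset ℕ) (x : ℕ → A) :
    finNorm s x = ‖(WithCStarModule.equiv A (s → A)).symm fun i => x i‖ := by
  rw [WithCStarModule.pi_norm, finNorm]
  congr 2
  exact (Finset.sum_coe_sort s fun i => x i * star (x i)).symm

theorem finNorm_add_le (s : Finset ℕ) (x y : ℕ → A) :
    finNorm s (x + y) ≤ finNorm s x + finNorm s y := by
  simp only [finNorm_eq]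
  exact norm_add_le ((WithCStarModule.equiv A (s → A)).symm fun i => x i)
    ((WithCStarModule.equiv A (s → A)).symm fun i => y i)

theorem norm_finInner_le (s : Finset ℕ) (x y : ℕ → A) :
    ‖∑ i ∈ s, y i * star (x i)‖ ≤ finNorm s x * finNorm s y := by
  simp only [finNorm_eq]
  have h := CStarModule.norm_inner_le (A := A) C⋆ᵐᵒᵈ(A, s → A)
    (x := (WithCStarModule.equiv A (s → A)).symm fun i => x i)
    (y := (WithCStarModule.equiv A (s → A)).symm fun i => y i)
  rw [WithCStarModule.pi_inner] at h
  rw [← Finset.sum_coe_sort s fun i => y i * star (x i)]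
  exact h

end order

theorem summable_iff_finNorm {A : Type u} [CStarAlgebra A] (x : ℕ → A) :
    (Summable fun i => x i * star (x i)) ↔
      ∀ ε > 0, ∃ s : Finset ℕ, ∀ t, Disjoint t s → finNorm t x < ε := by
  rw [summable_iff_vanishing_norm]
  constructor
  · intro h ε hε
    obtain ⟨s, hs⟩ := h (ε ^ 2) (by positivity)
    refine ⟨s, fun t ht => ?_⟩
    have := hs t ht
    rw [← finNorm_sq] at this
    exact lt_of_pow_lt_pow_left₀ 2 hε.le this
  · intro h ε hε
    obtain ⟨s, hs⟩ := h (√ε) (by positivity)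
    refine ⟨s, fun t ht => ?_⟩
    rw [← finNorm_sq, ← Real.sq_sqrt hε.le]
    exact pow_lt_pow_left₀ (hs t ht) (Real.sqrt_nonneg _) two_ne_zero

variable [PartialOrder A] [StarOrderedRing A]

/-- The sequences `x` in `A` for which `∑ x i (x i)⋆` converges in norm, as a submodule of the
left `A`-module of all sequences. (For series of positive elements, convergence of the partial
sums and unconditional convergence are the same.) -/
def ell2 : Submodule A (ℕ → A) where
  carrier := {x | Summable fun i => x i * star (x i)}
  zero_mem' := by simp [summable_zero]
  add_mem' := by
    intro x y hx hy
    rw [Set.mem_ofPred_eq, summable_iff_finNorm] at *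
    intro ε hε
    obtain ⟨s, hs⟩ := hx (ε / 2) (by positivity)
    obtain ⟨s', hs'⟩ := hy (ε / 2) (by positivity)
    refine ⟨s ∪ s', fun t ht => ?_⟩
    rw [Finset.disjoint_union_right] at ht
    linarith [finNorm_add_le t x y, hs t ht.1, hs' t ht.2]
  smul_mem' := by
    intro r x hx
    have := (hx.mul_left r).mul_right (star r)
    simpa [mul_assoc] using this

/-- The standard Hilbert module `H_A = ℓ²(A)`: square-summable sequences in `A`, with
`⟪x, y⟫ = ∑ y i (x i)⋆` and `‖x‖ = ‖⟪x, x⟫‖ ^ (1/2)`. -/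
def StandardModule : Type u := ell2 A

namespace StandardModule

noncomputable instance : AddCommGroup (StandardModule A) := inferInstanceAs (AddCommGroup (ell2 A))
noncomputable instance : Module A (StandardModule A) := inferInstanceAs (Module A (ell2 A))
noncomputable instance : Module ℂ (StandardModule A) := inferInstanceAs (Module ℂ (ell2 A))

variable {A}

/-- The `i`-th entry of an element of the standard module. -/
def coord (x : StandardModule A) (i : ℕ) : A := x.1 i

@[ext] theorem ext {x y : StandardModule A} (h : ∀ i, x.coord i = y.coord i) : x = y :=
  Subtype.ext (funext h)

@[simp] theorem coord_zero (i : ℕ) : (0 : StandardModule A).coord i = 0 := rfl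
@[simp] theorem coord_add (x y : StandardModule A) (i : ℕ) :
    (x + y).coord i = x.coord i + y.coord i := rfl
@[simp] theorem coord_sub (x y : StandardModule A) (i : ℕ) :
    (x - y).coord i = x.coord i - y.coord i := rfl
@[simp] theorem coord_smul (a : A) (x : StandardModule A) (i : ℕ) :
    (a • x).coord i = a * x.coord i := rfl
@[simp] theorem coord_smul_complex (z : ℂ) (x : StandardModule A) (i : ℕ) :
    (z • x).coord i = z • x.coord i := rfl

theorem summable_self (x : StandardModule A) :
    Summable fun i => x.coord i * star (x.coord i) := x.2

theorem summable_inner (x y : StandardModule A) :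
    Summable fun i => y.coord i * star (x.coord i) := by
  rw [summable_iff_vanishing_norm]
  intro ε hε
  obtain ⟨s, hs⟩ := (summable_iff_finNorm x.coord).1 x.summable_self 1 one_pos
  obtain ⟨s', hs'⟩ := (summable_iff_finNorm y.coord).1 y.summable_self ε hε
  refine ⟨s ∪ s', fun t ht => ?_⟩
  rw [Finset.disjoint_union_right] at ht
  have h0 : 0 ≤ finNorm t x.coord := Real.sqrt_nonneg _
  have h0' : 0 ≤ finNorm t y.coord := Real.sqrt_nonneg _
  have := norm_finInner_le t x.coord y.coord
  nlinarith [hs t ht.1, hs' t ht.2]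

noncomputable instance : Norm (StandardModule A) where
  norm x := √‖∑' i, x.coord i * star (x.coord i)‖

noncomputable instance : CStarModule A (StandardModule A) where
  inner x y := ∑' i, y.coord i * star (x.coord i)
  inner_add_right {x y z} := by
    rw [← (summable_inner x y).tsum_add (summable_inner x z)]
    simp [add_mul]
  inner_self_nonneg := tsum_nonneg fun i => mul_star_self_nonneg _
  inner_self {x} := by
    constructor
    · intro h
      have h0 := (hasSum_zero_iff_of_nonneg fun i => mul_star_self_nonneg (x.coord i)).1
        (h ▸ x.summable_self.hasSum)
      ext i
      exact (CStarRing.mul_star_self_eq_zero_iff _).1 (congrFun h0 i)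
    · rintro rfl
      simp
  inner_op_smul_right {a x y} := by
    rw [← (summable_inner x y).tsum_mul_left]
    simp [mul_assoc]
  inner_smul_right_complex {z x y} := by
    rw [← (summable_inner x y).tsum_const_smul]
    simp
  star_inner x y := by
    rw [tsum_star]
    simp
  norm_eq_sqrt_norm_inner_self _ := rfl

theorem inner_def (x y : StandardModule A) :
    inner A x y = ∑' i, y.coord i * star (x.coord i) := rfl

noncomputable instance : NormedAddCommGroup (StandardModule A) := CStarModule.normedAddCommGroup A
noncomputable instance : NormedSpace ℂ (StandardModule A) :=
  NormedSpace.ofCore (CStarModule.normedSpaceCore A)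

theorem finNorm_le_norm (s : Finset ℕ) (x : StandardModule A) : finNorm s x.coord ≤ ‖x‖ := by
  rw [CStarModule.norm_eq_sqrt_norm_inner_self (A := A)]
  refine Real.sqrt_le_sqrt (CStarAlgebra.norm_le_norm_of_nonneg_of_le
    (Finset.sum_nonneg fun i _ => mul_star_self_nonneg _) ?_)
  exact x.summable_self.sum_le_tsum s fun i _ => mul_star_self_nonneg _

theorem norm_le_of_finNorm {x : StandardModule A} {c : ℝ} (hc : 0 ≤ c)
    (h : ∀ s, finNorm s x.coord ≤ c) : ‖x‖ ≤ c := by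
  rw [CStarModule.norm_eq_sqrt_norm_inner_self (A := A), Real.sqrt_le_left hc]
  refine le_of_tendsto x.summable_self.hasSum.norm (Filter.Eventually.of_forall fun s => ?_)
  rw [← finNorm_sq]
  exact pow_le_pow_left₀ (Real.sqrt_nonneg _) (h s) 2

theorem norm_coord_le (x : StandardModule A) (i : ℕ) : ‖x.coord i‖ ≤ ‖x‖ := by
  have := finNorm_le_norm {i} x
  rwa [finNorm, Finset.sum_singleton, CStarRing.norm_self_mul_star,
    Real.sqrt_mul_self (norm_nonneg _)] at this

instance : CompleteSpace (StandardModule A) := by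
  refine Metric.complete_of_cauchySeq_tendsto fun u hu => ?_
  rw [Metric.cauchySeq_iff] at hu
  have hc : ∀ i, CauchySeq fun n => (u n).coord i := by
    intro i
    rw [Metric.cauchySeq_iff]
    intro ε hε
    obtain ⟨n, hn⟩ := hu ε hε
    refine ⟨n, fun k hk l hl => ?_⟩
    refine lt_of_le_of_lt ?_ (hn k hk l hl)
    rw [dist_eq_norm, dist_eq_norm, ← coord_sub]
    exact norm_coord_le _ i
  choose a ha using fun i => cauchySeq_tendsto_of_complete (hc i)
  have hlim : ∀ ε > 0, ∃ n, ∀ k ≥ n, ∀ s, finNorm s (a - (u k).coord) ≤ ε := by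
    intro ε hε
    obtain ⟨n, hn⟩ := hu ε hε
    refine ⟨n, fun k hk s => ?_⟩
    have ht : Filter.Tendsto (fun l => finNorm s ((u l).coord - (u k).coord)) Filter.atTop
        (nhds (finNorm s (a - (u k).coord))) := by
      refine ((Real.continuous_sqrt.tendsto _).comp
        (tendsto_finsetSum s fun i _ => ?_).norm)
      have := (ha i).sub_const ((u k).coord i)
      exact this.mul this.star
    refine le_of_tendsto ht (Filter.eventually_atTop.2 ⟨n, fun l hl => ?_⟩)
    refine (finNorm_le_norm s (u l - u k)).trans ?_
    rw [← dist_eq_norm]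
    exact (hn l hl k hk).le
  have hmem : Summable fun i => a i * star (a i) := by
    rw [summable_iff_finNorm]
    intro ε hε
    obtain ⟨n, hn⟩ := hlim (ε / 2) (by positivity)
    obtain ⟨s, hs⟩ := (summable_iff_finNorm _).1 (u n).summable_self (ε / 2) (by positivity)
    refine ⟨s, fun t ht => ?_⟩
    have h1 := finNorm_add_le t (a - (u n).coord) (u n).coord
    rw [sub_add_cancel] at h1
    linarith [hn n le_rfl t, hs t ht]
  let b : StandardModule A := ⟨a, hmem⟩
  refine ⟨b, ?_⟩
  rw [Metric.tendsto_atTop]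
  intro ε hε
  obtain ⟨n, hn⟩ := hlim (ε / 2) (by positivity)
  refine ⟨n, fun k hk => ?_⟩
  rw [dist_comm, dist_eq_norm]
  refine lt_of_le_of_lt (norm_le_of_finNorm (by positivity) fun s => hn k hk s)
    (half_lt_self hε)

end StandardModule
end StandardModule

section KTheory
variable (A : Type u) [Ring A]

/-- A finitely generated projective module over `A`. -/
structure FGProjective where
  carrier : Type u
  [addCommGroup : AddCommGroup carrier]
  [module : Module A carrier]
  [finite : Module.Finite A carrier]
  [projective : Module.Projective A carrier]

attribute [instance] FGProjective.addCommGroup FGProjective.module FGProjective.finite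
  FGProjective.projective

/-- Two modules are equivalent when they are isomorphic over `A`. -/
instance FGProjective.setoid : Setoid (FGProjective A) where
  r P Q := Nonempty (P.carrier ≃ₗ[A] Q.carrier)
  iseqv :=
    { refl := fun _ => ⟨LinearEquiv.refl A _⟩
      symm := fun ⟨e⟩ => ⟨e.symm⟩
      trans := fun ⟨e⟩ ⟨f⟩ => ⟨e.trans f⟩ }

/-- The isomorphism classes of finitely generated projective modules over `A`. -/
def IsoClass : Type (u + 1) := Quotient (FGProjective.setoid A)

/-- The sum of two isomorphism classes is the class of the direct sum. -/
instance : Add (IsoClass A) where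
  add := Quotient.map₂ (fun P Q => ⟨P.carrier × Q.carrier⟩)
    fun _ _ ⟨e⟩ _ _ ⟨f⟩ => ⟨e.prodCongr f⟩

instance : Zero (IsoClass A) where
  zero := Quotient.mk (FGProjective.setoid A) ⟨PUnit⟩

/-- Isomorphism classes form a commutative monoid under direct sums. -/
instance : AddCommMonoid (IsoClass A) where
  nsmul := nsmulRec
  add_assoc := by
    rintro ⟨P⟩ ⟨Q⟩ ⟨R⟩
    exact Quotient.sound ⟨LinearEquiv.prodAssoc A P.carrier Q.carrier R.carrier⟩
  zero_add := by
    rintro ⟨P⟩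
    exact Quotient.sound ⟨LinearEquiv.uniqueProd⟩
  add_zero := by
    rintro ⟨P⟩
    exact Quotient.sound ⟨LinearEquiv.prodUnique⟩
  add_comm := by
    rintro ⟨P⟩ ⟨Q⟩
    exact Quotient.sound ⟨LinearEquiv.prodComm A P.carrier Q.carrier⟩

/-- The group `K(A) = K₀(A)`: the Grothendieck group of the monoid of isomorphism classes of
finitely generated projective modules. -/
abbrev KGroup : Type (u + 1) := Algebra.GrothendieckAddGroup (IsoClass A)

variable {A}

/-- The class `[P]` in `K(A)` of a finitely generated projective module. -/
def KGroup.cls (P : FGProjective A) : KGroup A :=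
  Algebra.GrothendieckAddGroup.of (Quotient.mk (FGProjective.setoid A) P : IsoClass A)

end KTheory

section Fredholm
variable (A : Type u) [CStarAlgebra A] [PartialOrder A] [StarOrderedRing A]
variable (M : Type v) [NormedAddCommGroup M] [NormedSpace ℂ M] [Module A M] [CStarModule A M]
variable (N : Type w) [NormedAddCommGroup N] [NormedSpace ℂ N] [Module A N] [CStarModule A N]

/-- `B^a(M, N)`: the bounded adjointable `A`-linear operators from `M` to `N`. An operator is
stored together with its adjoint, which it determines (`AdjointableMap.ext`). -/
structure AdjointableMap where
  toCLM : M →L[A] N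
  adjCLM : N →L[A] M
  inner_adj : ∀ (x : M) (y : N), inner A (toCLM x) y = inner A x (adjCLM y)

variable {A M N}

/-- The adjoint `F* : N → M` of `F : M → N`. -/
def AdjointableMap.adjoint (F : AdjointableMap A M N) : AdjointableMap A N M where
  toCLM := F.adjCLM
  adjCLM := F.toCLM
  inner_adj y x := by
    rw [← CStarModule.star_inner x, ← F.inner_adj, CStarModule.star_inner]

theorem AdjointableMap.ext {F G : AdjointableMap A M N} (h : F.toCLM = G.toCLM) : F = G := by
  obtain ⟨F, F', hF⟩ := F
  obtain ⟨G, G', hG⟩ := G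
  obtain rfl : F = G := h
  have : F' = G' := by
    ext y
    exact ext_inner A fun x => by rw [← hF, hG]
  subst this
  rfl

/-- A decomposition `M = M₁ ⊕ N₁ → M₂ ⊕ N₂ = N` into topological direct sums of closed submodules
(not necessarily orthogonal), with respect to which `F` has the matrix `diag(F₁, F₄)`, where
`F₁ : M₁ → M₂` is an isomorphism. -/
structure Decomposition (F : AdjointableMap A M N) where
  M₁ : Submodule A M
  N₁ : Submodule A M
  M₂ : Submodule A N
  N₂ : Submodule A N
  isClosed_M₁ : IsClosed (M₁ : Set M)
  isClosed_N₁ : IsClosed (N₁ : Set M)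
  isClosed_M₂ : IsClosed (M₂ : Set N)
  isClosed_N₂ : IsClosed (N₂ : Set N)
  isCompl_dom : IsCompl M₁ N₁
  isCompl_cod : IsCompl M₂ N₂
  F₁ : M₁ ≃L[A] M₂
  apply_M₁ : ∀ x : M₁, F.toCLM x = F₁ x
  apply_N₁ : ∀ x ∈ N₁, F.toCLM x ∈ N₂

variable (A M N)

/-- `MΦ₊(M, N)`: the upper semi-`A`-Fredholm operators, for which `N₁` can be chosen finitely
generated. -/
def MPhiPlus : Set (AdjointableMap A M N) :=
  {F | ∃ D : Decomposition F, D.N₁.FG}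

/-- `MΦ₋(M, N)`: the lower semi-`A`-Fredholm operators, for which `N₂` can be chosen finitely
generated. -/
def MPhiMinus : Set (AdjointableMap A M N) :=
  {F | ∃ D : Decomposition F, D.N₂.FG}

/-- `MΦ(M, N)`: the `A`-Fredholm operators, for which `N₁` and `N₂` can be chosen finitely
generated in one and the same decomposition. -/
def MPhi : Set (AdjointableMap A M N) :=
  {F | ∃ D : Decomposition F, D.N₁.FG ∧ D.N₂.FG}

end Fredholm

section Index
variable {A : Type u} [CStarAlgebra A] [PartialOrder A] [StarOrderedRing A]
variable {M : Type u} [NormedAddCommGroup M] [NormedSpace ℂ M] [Module A M] [CStarModule A M]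
  [CompleteSpace M]
variable {N : Type u} [NormedAddCommGroup N] [NormedSpace ℂ N] [Module A N] [CStarModule A N]
  [CompleteSpace N]

/-- The class in `K(A)` of a finitely generated closed submodule, which is projective. -/
def submoduleClass (P : Submodule A M) (hcl : IsClosed (P : Set M)) (hfg : P.FG) : KGroup A :=
  have : Module.Finite A P := Module.Finite.of_fg hfg
  have : Module.Projective A P := projective_submodule P hcl hfg
  KGroup.cls ⟨P⟩

/-- The element `[N₁] - [N₂]` of `K(A)` given by a Fredholm decomposition. -/
def Decomposition.index {F : AdjointableMap A M N} (D : Decomposition F)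
    (h₁ : D.N₁.FG) (h₂ : D.N₂.FG) : KGroup A :=
  submoduleClass D.N₁ D.isClosed_N₁ h₁ - submoduleClass D.N₂ D.isClosed_N₂ h₂

/-- The index of an `A`-Fredholm operator: `[N₁] - [N₂]` for some Fredholm decomposition. -/
noncomputable def index (F : AdjointableMap A M N) (hF : F ∈ MPhi A M N) : KGroup A :=
  hF.choose.index hF.choose_spec.1 hF.choose_spec.2

end Index

end HilbertMod

open HilbertMod

/-! A decomposition of `F` cannot simply be dualised: its oblique projections and the isomorphism
`F₁` are bounded, but no adjoints are given for them. Finite generation removes the obstacle. A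
finitely generated closed submodule `P` is orthogonally complemented (`isCompl_orthogonal`), and an
operator `T` with an adjoint that is bounded below has `T⋆ T` invertible
(`exists_equiv_adjoint_comp`).

If `N₁` is finitely generated, put `X = N₁ᗮ`. Inverting `F₁` shows that `F` is bounded below on `X`,
so the compression of `F⋆ F` to `X` is invertible. If `N₂` is finitely generated, the same holds for
`F F⋆` on `N₂ᗮ`. In both cases `F⋆` acquires maps `B`, `R` with `R F⋆ B = 1`, and such a
factorisation is the same thing as a decomposition (`Decomposition.ofComp`). The new kernel part is
compared with `N₂` by showing that both are complements of one submodule.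

For the index, two decompositions of `F` give two-term complexes `N₁ → N₂` and `N₁' → N₂'`, both
obtained from `M → N` by splitting off an isomorphism. The mapping cone of the comparison map is a
short exact sequence, split by projectivity, so `N₂ × N₁' ≃ N₁ × N₂'`. The sign change under the
adjoint is then read off from one decomposition of `F` and the one it induces for `F⋆`. -/

namespace HilbertMod

open CStarModule
open scoped WithCStarModule

/-! ### Comparison of two block-diagonal forms -/

section Algebra
variable {A : Type u} [Ring A] {M : Type v} [AddCommGroup M] [Module A M]
  {N : Type w} [AddCommGroup N] [Module A N]

/-- A short exact sequence `0 → P₁ → P₂ → P₃ → 0` with `P₃` projective splits. -/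
theorem nonempty_equiv_prod_of_exact {P₁ P₂ P₃ : Type*} [AddCommGroup P₁] [Module A P₁]
    [AddCommGroup P₂] [Module A P₂] [AddCommGroup P₃] [Module A P₃] [Module.Projective A P₃]
    (f : P₁ →ₗ[A] P₂) (g : P₂ →ₗ[A] P₃) (hf : Function.Injective f)
    (hg : Function.Surjective g) (hfg : ∀ y, g y = 0 ↔ ∃ x, f x = y) :
    Nonempty (P₂ ≃ₗ[A] P₁ × P₃) := by
  obtain ⟨s, hs⟩ := Module.projective_lifting_property g LinearMap.id hg
  have hs' : ∀ z, g (s z) = z := fun z => LinearMap.congr_fun hs z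
  have hgf : ∀ x, g (f x) = 0 := fun x => (hfg _).2 ⟨x, rfl⟩
  refine ⟨(LinearEquiv.ofBijective (f.coprod s) ⟨?_, fun y => ?_⟩).symm⟩
  · rw [injective_iff_map_eq_zero]
    rintro ⟨x, z⟩ h
    rw [LinearMap.coprod_apply] at h
    have hz : z = 0 := by simpa [hgf, hs'] using congrArg g h
    subst hz
    rw [map_zero, add_zero] at h
    exact Prod.ext ((map_eq_zero_iff f hf).1 h) rfl
  · obtain ⟨x, hx⟩ := (hfg (y - s (g y))).1 (by rw [map_sub, hs', sub_self])
    exact ⟨(x, g y), by rw [LinearMap.coprod_apply, hx, sub_add_cancel]⟩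

/-- If `F : M → N` is block diagonal with invertible first block for two pairs of decompositions
of `M` and `N`, then the second blocks have the same Euler characteristic. -/
theorem nonempty_equiv_of_blockDiagonal (F : M →ₗ[A] N) {M₁ N₁ M₁' N₁' : Submodule A M}
    {M₂ N₂ M₂' N₂' : Submodule A N}
    (hd : IsCompl M₁ N₁) (hc : IsCompl M₂ N₂) (hd' : IsCompl M₁' N₁') (hc' : IsCompl M₂' N₂')
    (e : M₁ ≃ₗ[A] M₂) (he : ∀ x : M₁, F x = e x) (hN : ∀ x ∈ N₁, F x ∈ N₂)
    (e' : M₁' ≃ₗ[A] M₂') (he' : ∀ x : M₁', F x = e' x) (hN' : ∀ x ∈ N₁', F x ∈ N₂')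
    [Module.Projective A N₂'] :
    Nonempty ((N₂ × N₁') ≃ₗ[A] N₁ × N₂') := by
  have hmem : ∀ x ∈ M₁, F x ∈ M₂ := fun x hx => by rw [he ⟨x, hx⟩]; exact (e _).2
  have hmem' : ∀ x ∈ M₁', F x ∈ M₂' := fun x hx => by rw [he' ⟨x, hx⟩]; exact (e' _).2
  have hinj : ∀ x ∈ M₁, F x = 0 → x = 0 := fun x hx h => by
    rw [he ⟨x, hx⟩, ZeroMemClass.coe_eq_zero, e.map_eq_zero_iff] at h
    exact congrArg Subtype.val h
  have hinj' : ∀ x ∈ M₁', F x = 0 → x = 0 := fun x hx h => by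
    rw [he' ⟨x, hx⟩, ZeroMemClass.coe_eq_zero, e'.map_eq_zero_iff] at h
    exact congrArg Subtype.val h
  have hsurj : ∀ y ∈ M₂, ∃ x ∈ M₁, F x = y := fun y hy =>
    ⟨e.symm ⟨y, hy⟩, (e.symm _).2, by rw [he, e.apply_symm_apply]⟩
  have hsurj' : ∀ y ∈ M₂', ∃ x ∈ M₁', F x = y := fun y hy =>
    ⟨e'.symm ⟨y, hy⟩, (e'.symm _).2, by rw [he', e'.apply_symm_apply]⟩
  let π₁ := N₁'.projectionOnto M₁' hd'.symm
  let π₂ := N₂'.projectionOnto M₂' hc'.symm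
  have hπ₁ : ∀ x, x - π₁ x ∈ M₁' := fun x => N₁'.sub_projection_mem hd'.symm x
  have hπ₂ : ∀ x, x - π₂ x ∈ M₂' := fun x => N₂'.sub_projection_mem hc'.symm x
  -- The projections form a chain map, since `F` respects both summands of the primed decomposition.
  have hcomm : ∀ x, (π₂ (F x) : N) = F (π₁ x) := fun x => by
    have h1 : π₂ (F (x - π₁ x)) = 0 :=
      (Submodule.projectionOnto_apply_eq_zero_iff hc'.symm).2 (hmem' _ (hπ₁ x))
    rw [map_sub, map_sub, sub_eq_zero] at h1
    rw [h1]
    exact congrArg Subtype.val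
      (N₂'.projectionOnto_apply_left hc'.symm ⟨_, hN' _ (π₁ x).2⟩)
  let F₄ : N₁ →ₗ[A] N₂ := F.restrict hN
  let F₄' : N₁' →ₗ[A] N₂' := F.restrict hN'
  -- The mapping cone `N₁ → N₂ × N₁' → N₂'`, with maps `x ↦ (F x, π₁ x)` and `(a, b) ↦ π₂ a - F b`.
  refine nonempty_equiv_prod_of_exact (F₄.prod (π₁ ∘ₗ N₁.subtype))
    ((π₂ ∘ₗ N₂.subtype) ∘ₗ LinearMap.fst A N₂ N₁' - F₄' ∘ₗ LinearMap.snd A N₂ N₁') ?_ ?_ ?_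
  · rw [injective_iff_map_eq_zero]
    intro x h
    obtain ⟨h1, h2⟩ := Prod.ext_iff.1 h
    have h1' : F x = 0 := congrArg Subtype.val h1
    have h2' : (x : M) ∈ M₁' := (Submodule.projectionOnto_apply_eq_zero_iff hd'.symm).1 h2
    exact Subtype.ext (hinj' _ h2' h1')
  · intro c
    obtain ⟨b, a, hb, ha, hab⟩ := Submodule.codisjoint_iff_exists_add_eq.1 hc.codisjoint (c : N)
    obtain ⟨m, hm, rfl⟩ := hsurj b hb
    -- With `c = F m + a`, applying `π₂` gives `c = F (π₁ m) + π₂ a`.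
    refine ⟨(⟨a, ha⟩, -π₁ m), Subtype.ext ?_⟩
    have h1 : (π₂ (c : N) : N) = c :=
      congrArg Subtype.val (N₂'.projectionOnto_apply_left hc'.symm c)
    rw [← hab, map_add, Submodule.coe_add, hcomm] at h1
    change (π₂ a : N) - F ((-π₁ m : N₁') : M) = c
    rw [← h1.trans hab, Submodule.coe_neg, map_neg, sub_neg_eq_add, add_comm]
  · rintro ⟨a, b⟩
    constructor
    · intro h
      -- Here `a - F b` lies in `M₂'`, hence equals `F m'` with `m'` in `M₁'`. The preimage sought
      -- is the `N₁`-component of `b + m'`; the `M₁`-component vanishes because its image lies in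
      -- both `M₂` and `N₂`.
      have h1 : (π₂ (a : N) : N) = F b := sub_eq_zero.1 (congrArg Subtype.val h)
      have h2 := hπ₂ a
      rw [h1] at h2
      obtain ⟨m', hm', h3⟩ := hsurj' _ h2
      obtain ⟨m, n, hm, hn, hmn⟩ :=
        Submodule.codisjoint_iff_exists_add_eq.1 hd.codisjoint ((b : M) + m')
      have h4 : F m + F n = a := by
        rw [← map_add, hmn, map_add, h3, add_sub_cancel]
      have h5 : F m = 0 := by
        refine Submodule.disjoint_def.1 hc.disjoint _ (hmem m hm) ?_
        rw [← eq_sub_iff_add_eq] at h4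
        rw [h4]
        exact N₂.sub_mem a.2 (hN n hn)
      obtain rfl := hinj m hm h5
      rw [zero_add] at hmn
      refine ⟨⟨n, hn⟩, Prod.ext (Subtype.ext ?_) ?_⟩
      · change F n = a
        rw [← h4, map_zero, zero_add]
      · change π₁ n = b
        rw [hmn, map_add, (Submodule.projectionOnto_apply_eq_zero_iff hd'.symm).2 hm', add_zero]
        exact N₁'.projectionOnto_apply_left hd'.symm b
    · rintro ⟨x, hx⟩
      obtain ⟨rfl, rfl⟩ := Prod.ext_iff.1 hx
      refine Subtype.ext (sub_eq_zero.2 ?_)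
      exact hcomm x

end Algebra

/-! ### Invertibility of `T⋆ T`, and orthogonal complements -/

section Operators
variable {A : Type u} [CStarAlgebra A] [PartialOrder A] [StarOrderedRing A]
variable {E : Type v} [NormedAddCommGroup E] [NormedSpace ℂ E] [Module A E] [CStarModule A E]
variable {F : Type w} [NormedAddCommGroup F] [NormedSpace ℂ F] [Module A F] [CStarModule A F]

/-- A continuous `A`-linear operator is bounded. -/
theorem exists_norm_le (T : E →L[A] F) : ∃ C > 0, ∀ x, ‖T x‖ ≤ C * ‖x‖ := by
  have := isScalarTower A E
  have := isScalarTower A F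
  obtain ⟨C, hC, h⟩ := (T.restrictScalars ℂ).bound
  exact ⟨C, hC, h⟩

/-- If `T` is bounded below and has an adjoint, then `T⋆ T` is invertible. -/
theorem exists_equiv_adjoint_comp [CompleteSpace E] (T : E →L[A] F) (T' : F →L[A] E)
    (h : ∀ x y, inner A (T x) y = inner A x (T' y)) {C : ℝ} (hC : 0 < C)
    (hb : ∀ x, ‖x‖ ≤ C * ‖T x‖) : ∃ S : E ≃L[A] E, ∀ x, S x = T' (T x) := by
  have := isScalarTower A E
  have hunit : IsUnit ((T' ∘L T).restrictScalars ℂ) := by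
    -- Positivity gives `⟪T y, T y⟫ ≤ ⟪y, (T⋆ T + t) y⟫` for `t ≥ 0`. With Cauchy-Schwarz and `‖y‖ ≤
    -- C ‖T y‖` this yields the lower bound `C⁻²`, uniformly in `t`.
    refine isUnit_of_bddBelow (c := (C ^ 2)⁻¹) _ (by positivity) fun t ht y => ?_
    rcases eq_or_ne y 0 with rfl | hy
    · simp
    have hy' : 0 < ‖y‖ := norm_pos_iff.2 hy
    have h1 : ‖inner A (T y) (T y)‖ ≤ ‖y‖ * ‖T' (T y) + t • y‖ := by
      calc ‖inner A (T y) (T y)‖ ≤ ‖inner A y (T' (T y) + t • y)‖ := by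
            refine CStarAlgebra.norm_le_norm_of_nonneg_of_le inner_self_nonneg ?_
            rw [CStarModule.inner_add_right, ← h, CStarModule.inner_smul_right_real]
            exact le_add_of_nonneg_right (smul_nonneg ht inner_self_nonneg)
        _ ≤ _ := norm_inner_le E
    rw [← CStarModule.norm_sq_eq A] at h1
    have h3 : ‖y‖ ^ 2 ≤ C ^ 2 * (‖y‖ * ‖T' (T y) + t • y‖) := by
      calc ‖y‖ ^ 2 ≤ (C * ‖T y‖) ^ 2 := by gcongr; exact hb y
        _ = C ^ 2 * ‖T y‖ ^ 2 := by ring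
        _ ≤ _ := by gcongr
    change (C ^ 2)⁻¹ * ‖y‖ ≤ ‖T' (T y) + t • y‖
    rw [inv_mul_le_iff₀ (by positivity)]
    nlinarith
  obtain ⟨U, hU⟩ := hunit
  let e := ContinuousLinearEquiv.unitsEquiv ℂ E U
  have he : ∀ x, e x = T' (T x) := fun x => by
    rw [ContinuousLinearEquiv.unitsEquiv_apply, hU]; rfl
  have hbij : Function.Bijective (T' ∘L T).toLinearMap := by
    convert e.bijective using 1
    exact funext fun x => (he x).symm
  let S := LinearEquiv.ofBijective _ hbij
  -- The `A`-linear inverse inherits continuity from the complex-linear one, being the same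
  -- function.
  have hS : ∀ x, S.symm x = e.symm x := fun x => by
    rw [S.symm_apply_eq, ← e.apply_symm_apply x, e.symm_apply_apply]
    exact he _
  exact ⟨{ toLinearEquiv := S
           continuous_toFun := (T' ∘L T).continuous
           continuous_invFun := by
            convert e.symm.continuous using 1
            exact funext hS }, fun x => rfl⟩

/-- The projection onto a closed submodule along a closed complement is continuous. -/
theorem continuous_projectionOnto [CompleteSpace E] {p q : Submodule A E} (h : IsCompl p q)
    (hp : IsClosed (p : Set E)) (hq : IsClosed (q : Set E)) :
    Continuous (p.projectionOnto q h) := by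
  have := isScalarTower A E
  have hc : Continuous ((p.projection q h).restrictScalars ℂ) := by
    -- Closed graph theorem: in the limit `b ∈ p` and `a - b ∈ q`, so `b` is the projection of `a`.
    refine LinearMap.continuous_of_seq_closed_graph _ fun x a b hx hb => ?_
    have h1 : b ∈ p := hp.mem_of_tendsto hb
      (Filter.Eventually.of_forall fun n => p.projection_apply_mem h (x n))
    have h2 : a - b ∈ q := hq.mem_of_tendsto (hx.sub hb)
      (Filter.Eventually.of_forall fun n => p.sub_projection_mem h (x n))
    have h3 := (Submodule.projection_apply_eq_zero_iff h).2 h2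
    rw [map_sub, sub_eq_zero, Submodule.projection_apply_of_mem_left h h1] at h3
    exact h3.symm
  exact Continuous.subtype_mk hc _

/-- The projection onto a closed submodule along a closed complement. -/
noncomputable def projL [CompleteSpace E] {p q : Submodule A E} (h : IsCompl p q)
    (hp : IsClosed (p : Set E)) (hq : IsClosed (q : Set E)) : E →L[A] p :=
  ⟨p.projectionOnto q h, continuous_projectionOnto h hp hq⟩

/-- A submodule of a Hilbert module, with the restricted inner product. -/
noncomputable instance submoduleCStarModule [IsScalarTower ℂ A E] (p : Submodule A E) :
    CStarModule A p where
  inner x y := inner A (x : E) (y : E)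
  inner_add_right := by simp
  inner_self_nonneg := CStarModule.inner_self_nonneg
  inner_self := by intro x; rw [CStarModule.inner_self]; simp
  inner_op_smul_right := by simp
  inner_smul_right_complex := by simp
  star_inner := by simp
  norm_eq_sqrt_norm_inner_self x :=
    CStarModule.norm_eq_sqrt_norm_inner_self (A := A) (x : E)

/-- The orthogonal complement of a submodule. -/
def orthogonal (p : Submodule A E) : Submodule A E where
  carrier := {y | ∀ x ∈ p, inner A x y = 0}
  add_mem' ha hb x hx := by rw [CStarModule.inner_add_right, ha x hx, hb x hx, add_zero]
  zero_mem' x _ := inner_zero_right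
  smul_mem' c a ha x hx := by rw [inner_op_smul_right, ha x hx, mul_zero]

theorem isClosed_orthogonal (p : Submodule A E) : IsClosed (orthogonal p : Set E) := by
  have : (orthogonal p : Set E) = ⋂ x ∈ p, {y | innerSL (A := A) x y = 0} := by
    ext y
    simp only [Set.mem_iInter]
    exact Iff.rfl
  rw [this]
  exact isClosed_biInter fun x _ => isClosed_eq (innerSL (A := A) x).continuous continuous_const

omit [StarOrderedRing A] in
theorem inner_eq_zero_of_mem_orthogonal {p : Submodule A E} {x y : E} (hx : x ∈ orthogonal p)
    (hy : y ∈ p) : inner A x y = 0 := by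
  rw [← CStarModule.star_inner, hx y hy, star_zero]

/-- A finitely generated closed submodule of a Hilbert module is orthogonally complemented. -/
theorem isCompl_orthogonal [CompleteSpace E] {p : Submodule A E} (hcl : IsClosed (p : Set E))
    (hfg : p.FG) : IsCompl p (orthogonal p) := by
  have := isScalarTower A E
  have : CompleteSpace p := hcl.completeSpace_coe
  obtain ⟨n, x, hx⟩ := Submodule.fg_iff_exists_fin_generating_family.1 hfg
  have hxp : ∀ i, x i ∈ p := fun i => hx ▸ Submodule.subset_span ⟨i, rfl⟩
  have := isScalarTower A C⋆ᵐᵒᵈ(A, Fin n → A)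
  -- `T` sends coefficients to combinations of the generators, and `B` is its adjoint, defined on
  -- all of `E`.
  let T : C⋆ᵐᵒᵈ(A, Fin n → A) →ₗ[A] p :=
    { toFun := fun a => ∑ i, a i • (⟨x i, hxp i⟩ : p)
      map_add' := fun a b => by
        rw [← Finset.sum_add_distrib]
        exact Finset.sum_congr rfl fun i _ => add_smul _ _ _
      map_smul' := fun r a => by
        rw [RingHom.id_apply, Finset.smul_sum]
        exact Finset.sum_congr rfl fun i _ => by rw [← mul_smul]; rfl }
  let B : E →ₗ[A] C⋆ᵐᵒᵈ(A, Fin n → A) :=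
    { toFun := fun y => (WithCStarModule.equiv A (Fin n → A)).symm fun i => inner A (x i) y
      map_add' := fun a b => by ext i; exact CStarModule.inner_add_right
      map_smul' := fun r a => by ext i; exact CStarModule.inner_op_smul_right }
  have hTB : ∀ (y : E) (a : C⋆ᵐᵒᵈ(A, Fin n → A)), inner A y (T a : E) = inner A (B y) a := by
    intro y a
    rw [WithCStarModule.pi_inner]
    change inner A y ((∑ i, a i • (⟨x i, hxp i⟩ : p) : p) : E) = ∑ i, a i * star (inner A (x i) y)
    simp
  have hTsurj : Function.Surjective T := by
    intro y
    have : (y : E) ∈ Submodule.span A (Set.range x) := by rw [hx]; exact y.2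
    obtain ⟨a, ha⟩ := (Submodule.mem_span_range_iff_exists_fun A).1 this
    exact ⟨(WithCStarModule.equiv A (Fin n → A)).symm a, Subtype.ext (by simpa [T] using ha)⟩
  have hTc : Continuous T := by
    refine ((T.restrictScalars ℂ).mkContinuous (∑ i, ‖x i‖) fun a => ?_).continuous
    rw [Finset.sum_mul]
    change ‖∑ i, a i • (⟨x i, hxp i⟩ : p)‖ ≤ _
    refine (norm_sum_le _ _).trans (Finset.sum_le_sum fun i _ => ?_)
    rw [mul_comm]
    exact (norm_smul_le' _ _).trans
      (by gcongr; exacts [WithCStarModule.norm_apply_le_norm a i, le_rfl])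
  have hBc : Continuous B := by
    refine ((B.restrictScalars ℂ).mkContinuous (∑ i, ‖x i‖) fun y => ?_).continuous
    rw [Finset.sum_mul]
    refine (WithCStarModule.pi_norm_le_sum_norm _).trans (Finset.sum_le_sum fun i _ => ?_)
    exact norm_inner_le E
  let Tc : C⋆ᵐᵒᵈ(A, Fin n → A) →L[A] p := ⟨T, hTc⟩
  let Bc : p →L[A] C⋆ᵐᵒᵈ(A, Fin n → A) := ⟨B ∘ₗ p.subtype, hBc.comp continuous_subtype_val⟩
  -- By the open mapping theorem, each `y` in `p` is `T a` with `‖a‖ ≤ C ‖y‖`. Pairing `y` with `T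
  -- a` then bounds `B` below on `p`.
  obtain ⟨C, hC, hpre⟩ := (Tc.restrictScalars ℂ).exists_preimage_norm_le hTsurj
  have hlow : ∀ y : p, ‖y‖ ≤ C * ‖Bc y‖ := by
    intro y
    obtain ⟨a, ha, han⟩ := hpre y
    rcases eq_or_ne y 0 with rfl | hy
    · simp
    have h1 : ‖y‖ ^ 2 ≤ ‖B y‖ * (C * ‖y‖) := by
      calc ‖y‖ ^ 2 = ‖inner A (y : E) (T a : E)‖ := by
            rw [CStarModule.norm_sq_eq A]; congr 2; exact ha.symm
        _ = ‖inner A (B y) a‖ := by rw [hTB]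
        _ ≤ ‖B y‖ * ‖a‖ := norm_inner_le C⋆ᵐᵒᵈ(A, Fin n → A)
        _ ≤ _ := by gcongr
    have hy' : 0 < ‖y‖ := norm_pos_iff.2 hy
    change ‖y‖ ≤ C * ‖B y‖
    nlinarith
  obtain ⟨S, hS⟩ := exists_equiv_adjoint_comp Bc Tc
    (fun y a => by change inner A (B y) a = inner A (y : E) (T a : E); rw [hTB]) hC hlow
  refine ⟨Submodule.disjoint_def.2 fun y hy hy' => ?_,
    Submodule.codisjoint_iff_exists_add_eq.2 fun y => ?_⟩
  · exact (CStarModule.inner_self (A := A)).1 (hy' y hy)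
  -- The orthogonal projection is `S⁻¹ T B`, where `S` is `T B` on `p`. The remainder `z` has `T (B
  -- z) = 0`, so `⟪B z, B z⟫ = ⟪z, T (B z)⟫ = 0` and `z` is orthogonal to every generator.
  · refine ⟨S.symm (T (B y)), y - S.symm (T (B y)), (S.symm _).2, ?_, add_sub_cancel _ _⟩
    set z := y - S.symm (T (B y)) with hz
    have h1 : T (B z) = 0 := by
      have h2 := hS (S.symm (T (B y)))
      rw [S.apply_symm_apply] at h2
      rw [hz, map_sub, map_sub, sub_eq_zero]
      exact h2
    have h3 : B z = 0 := by
      rw [← CStarModule.inner_self (A := A), ← hTB, h1, Submodule.coe_zero, CStarModule.inner_zero_right]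
    have h4 : ∀ i, inner A (x i) z = 0 := fun i =>
      congrArg (fun a : C⋆ᵐᵒᵈ(A, Fin n → A) => a i) h3
    intro w hw
    rw [← hx] at hw
    induction hw using Submodule.span_induction with
    | mem w hw => obtain ⟨i, rfl⟩ := hw; exact h4 i
    | zero => exact inner_zero_left
    | add a b _ _ ha hb => rw [CStarModule.inner_add_left, ha, hb, add_zero]
    | smul c a _ ha => rw [inner_op_smul_left, ha, zero_mul]

end Operators
-- Decompositions of the adjoint
section Decompositions
variable {A : Type u} [CStarAlgebra A] [PartialOrder A] [StarOrderedRing A]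
variable {M : Type v} [NormedAddCommGroup M] [NormedSpace ℂ M] [Module A M] [CStarModule A M]
variable {N : Type w} [NormedAddCommGroup N] [NormedSpace ℂ N] [Module A N] [CStarModule A N]

/-- If `R F B = 1`, then `F` maps `range B` isomorphically onto `range (F B)`, and these have the
complements `ker (R F)` and `ker R`. -/
def Decomposition.ofComp (F : AdjointableMap A M N) {X : Type*} [NormedAddCommGroup X]
    [Module A X] (B : X →L[A] M) (R : N →L[A] X) (h : ∀ x, R (F.toCLM (B x)) = x) :
    Decomposition F where
  M₁ := B.toLinearMap.range
  N₁ := (R ∘L F.toCLM).toLinearMap.ker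
  M₂ := (F.toCLM ∘L B).toLinearMap.range
  N₂ := R.toLinearMap.ker
  isClosed_M₁ := by
    -- `B R F` is idempotent, so the range of `B` is its closed set of fixed points.
    convert isClosed_eq (B ∘L R ∘L F.toCLM).continuous continuous_id
    ext x
    exact ⟨by rintro ⟨y, rfl⟩; exact congrArg B (h y), fun hx => ⟨_, hx⟩⟩
  isClosed_N₁ := isClosed_singleton.preimage (R ∘L F.toCLM).continuous
  isClosed_M₂ := by
    convert isClosed_eq (F.toCLM ∘L B ∘L R).continuous continuous_id
    ext x
    exact ⟨by rintro ⟨y, rfl⟩; exact congrArg (fun z => F.toCLM (B z)) (h y), fun hx => ⟨_, hx⟩⟩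
  isClosed_N₂ := isClosed_singleton.preimage R.continuous
  isCompl_dom := by
    refine ⟨Submodule.disjoint_def.2 ?_, Submodule.codisjoint_iff_exists_add_eq.2 fun x =>
      ⟨B (R (F.toCLM x)), x - B (R (F.toCLM x)), ⟨_, rfl⟩, ?_, add_sub_cancel _ _⟩⟩
    · rintro _ ⟨x, rfl⟩ hx
      have : R (F.toCLM (B x)) = 0 := hx
      rw [h] at this
      subst this
      exact map_zero B
    · change R (F.toCLM (x - B (R (F.toCLM x)))) = 0
      rw [map_sub, map_sub, h, sub_self]
  isCompl_cod := by
    refine ⟨Submodule.disjoint_def.2 ?_, Submodule.codisjoint_iff_exists_add_eq.2 fun x =>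
      ⟨F.toCLM (B (R x)), x - F.toCLM (B (R x)), ⟨_, rfl⟩, ?_, add_sub_cancel _ _⟩⟩
    · rintro _ ⟨x, rfl⟩ hx
      have : R (F.toCLM (B x)) = 0 := hx
      rw [h] at this
      subst this
      exact map_zero (F.toCLM ∘L B)
    · change R (x - F.toCLM (B (R x))) = 0
      rw [map_sub, h, sub_self]
  F₁ :=
    { toFun := fun x => ⟨F.toCLM x, x.2.imp fun _ hy => congrArg F.toCLM hy⟩
      map_add' := fun x y => Subtype.ext (map_add F.toCLM _ _)
      map_smul' := fun a x => Subtype.ext (map_smul F.toCLM _ _)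
      invFun := fun y => ⟨B (R y), _, rfl⟩
      left_inv := by rintro ⟨_, x, rfl⟩; exact Subtype.ext (congrArg B (h x))
      right_inv := by
        rintro ⟨_, x, rfl⟩
        exact Subtype.ext (congrArg (fun z => F.toCLM (B z)) (h x))
      continuous_toFun := (F.toCLM.continuous.comp continuous_subtype_val).subtype_mk _
      continuous_invFun := ((B ∘L R).continuous.comp continuous_subtype_val).subtype_mk _ }
  apply_M₁ _ := rfl
  apply_N₁ _ hx := hx

/-- An adjointable operator `F` that is bounded below on a submodule `X` with complement
orthogonal to it has invertible compression of `F⋆ F` to `X`. -/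
theorem exists_equiv_compression [CompleteSpace M] (F : AdjointableMap A M N) {p : Submodule A M}
    (hp : IsClosed (p : Set M)) (hc : IsCompl p (orthogonal p)) {C : ℝ} (hC : 0 < C)
    (hb : ∀ x ∈ orthogonal p, ‖x‖ ≤ C * ‖F.toCLM x‖) :
    ∃ S : orthogonal p ≃L[A] orthogonal p,
      ∀ x, S x = projL hc.symm (isClosed_orthogonal p) hp (F.adjCLM (F.toCLM x)) := by
  have := isScalarTower A M
  have : CompleteSpace (orthogonal p) := (isClosed_orthogonal p).completeSpace_coe
  refine exists_equiv_adjoint_comp (F.toCLM ∘L (orthogonal p).subtypeL)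
    (projL hc.symm (isClosed_orthogonal p) hp ∘L F.adjCLM) (fun x y => ?_) hC
    fun x => hb x x.2
  change inner A (F.toCLM x) y =
    inner A (x : M) ((orthogonal p).projectionOnto p hc.symm (F.adjCLM y) : M)
  -- Projecting `F⋆ y` changes it by an element of `p`, which is invisible to `x` in `orthogonal p`;
  -- hence the projected `F⋆` is the adjoint of `F` restricted to `orthogonal p`.
  rw [F.inner_adj, ← sub_eq_zero, ← CStarModule.inner_sub_right]
  exact inner_eq_zero_of_mem_orthogonal x.2 (Submodule.sub_projection_mem hc.symm _)

variable [CompleteSpace M] [CompleteSpace N]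

omit [CompleteSpace M] in
/-- Extending `F₁⁻¹` by zero on `N₂` gives a partial inverse of `F` with values in `M₁`. -/
theorem Decomposition.exists_leftInverse {F : AdjointableMap A M N} (D : Decomposition F) :
    ∃ L : N →L[A] M, (∀ y, L y ∈ D.M₁) ∧ (∀ x, x - L (F.toCLM x) ∈ D.N₁) ∧
      ∀ y, y - F.toCLM (L y) ∈ D.N₂ := by
  let π := projL D.isCompl_cod D.isClosed_M₂ D.isClosed_N₂
  have hF : ∀ y, F.toCLM (D.F₁.symm (π y)) = π y := fun y => by
    rw [D.apply_M₁, D.F₁.apply_symm_apply]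
  refine ⟨D.M₁.subtypeL ∘L D.F₁.symm ∘L π, fun y => (D.F₁.symm (π y)).2, fun x => ?_, fun y => ?_⟩
  · obtain ⟨m, n, hm, hn, rfl⟩ :=
      Submodule.codisjoint_iff_exists_add_eq.1 D.isCompl_dom.codisjoint x
    have h1 : π (F.toCLM (m + n)) = D.F₁ ⟨m, hm⟩ := by
      change Submodule.projectionOnto _ _ _ _ = _
      rw [map_add, map_add, (Submodule.projectionOnto_apply_eq_zero_iff D.isCompl_cod).2
        (D.apply_N₁ n hn), add_zero, D.apply_M₁ ⟨m, hm⟩]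
      exact Submodule.projectionOnto_apply_left _ _
    change m + n - (D.F₁.symm (π (F.toCLM (m + n))) : M) ∈ D.N₁
    rw [h1, D.F₁.symm_apply_apply]
    simpa using hn
  · change y - F.toCLM (D.F₁.symm (π y)) ∈ D.N₂
    rw [hF]
    exact Submodule.sub_projection_mem D.isCompl_cod y

/-- A decomposition of `F` with `N₁` finitely generated gives a decomposition of `F⋆` in which the
roles of `N₁` and `N₂` are exchanged. -/
theorem Decomposition.exists_adjoint_of_fg {F : AdjointableMap A M N} (D : Decomposition F)
    (hfg : D.N₁.FG) :
    ∃ D' : Decomposition F.adjoint, D'.N₂ = D.N₁ ∧ Nonempty (D.N₂ ≃ₗ[A] D'.N₁) := by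
  have := isScalarTower A M
  have hc := isCompl_orthogonal D.isClosed_N₁ hfg
  let X := orthogonal D.N₁
  have hX : IsClosed (X : Set M) := isClosed_orthogonal D.N₁
  let π : M →L[A] X := projL hc.symm hX D.isClosed_N₁
  have hπ : ∀ y, π y = 0 ↔ y ∈ D.N₁ := fun y => Submodule.projectionOnto_apply_eq_zero_iff hc.symm
  have hπX : ∀ x : X, π x = x := fun x => Submodule.projectionOnto_apply_left hc.symm x
  obtain ⟨L, hL, hLF, hFL⟩ := D.exists_leftInverse
  -- `π L` is a bounded left inverse of `F` on `X`, so `F` is bounded below there.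
  have hleft : ∀ x : X, π (L (F.toCLM x)) = x := fun x => by
    have := (hπ _).2 (hLF x)
    rw [map_sub, sub_eq_zero, hπX] at this
    exact this.symm
  obtain ⟨C, hC, hb⟩ := exists_norm_le (π ∘L L)
  obtain ⟨S, hS⟩ := exists_equiv_compression F D.isClosed_N₁ hc hC fun x hx => by
    have h1 := hb (F.toCLM x)
    rwa [show (π ∘L L) (F.toCLM x) = ⟨x, hx⟩ from hleft ⟨x, hx⟩] at h1
  let D' : Decomposition F.adjoint := .ofComp F.adjoint
    (F.toCLM ∘L X.subtypeL ∘L S.symm.toContinuousLinearMap) π fun x => by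
      change π (F.adjCLM (F.toCLM (S.symm x))) = x
      rw [← hS, S.apply_symm_apply]
  refine ⟨D', Submodule.ext hπ, ?_⟩
  -- `D'.M₁` is `F(X)`, in general different from `D.M₂`, but it is still a complement of `D.N₂`.
  -- Hence `D.N₂` and `D'.N₁` are both isomorphic to the quotient of `N` by it.
  have h1 : IsCompl D'.M₁ D.N₂ := by
    have hM₁ : ∀ y, y ∈ D'.M₁ ↔ ∃ x : X, F.toCLM x = y := by
      intro y
      constructor
      · rintro ⟨x, hx⟩
        exact ⟨S.symm x, hx⟩
      · rintro ⟨x, rfl⟩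
        exact ⟨S x, congrArg (fun z : X => F.toCLM z) (S.symm_apply_apply x)⟩
    refine ⟨Submodule.disjoint_def.2 fun y hy hy' => ?_,
      Submodule.codisjoint_iff_exists_add_eq.2 fun y => ?_⟩
    · obtain ⟨x, rfl⟩ := (hM₁ y).1 hy
      have h2 : F.toCLM (L (F.toCLM x)) = 0 := by
        refine Submodule.disjoint_def.1 D.isCompl_cod.disjoint _ ?_ ?_
        · rw [D.apply_M₁ ⟨_, hL _⟩]; exact (D.F₁ _).2
        · have := D.N₂.sub_mem hy' (hFL (F.toCLM x))
          rwa [sub_sub_cancel] at this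
      have h3 : L (F.toCLM x) = 0 := by
        rw [D.apply_M₁ ⟨_, hL _⟩, ZeroMemClass.coe_eq_zero, D.F₁.map_eq_zero_iff] at h2
        exact congrArg Subtype.val h2
      have h4 := hleft x
      rw [h3, map_zero] at h4
      rw [← h4, Submodule.coe_zero, map_zero]
    · refine ⟨F.toCLM (π (L y)), y - F.toCLM (π (L y)), (hM₁ _).2 ⟨_, rfl⟩, ?_,
        add_sub_cancel _ _⟩
      -- The remainder is `(y - F L y) + F (L y - π L y)`, and both terms lie in `N₂`.
      have h2 : L y - π (L y) ∈ D.N₁ := Submodule.sub_projection_mem hc.symm _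
      have h3 := D.N₂.add_mem (hFL y) (D.apply_N₁ _ h2)
      rwa [map_sub, sub_add_sub_cancel] at h3
  exact ⟨(Submodule.quotientEquivOfIsCompl _ _ h1).symm.trans
    (Submodule.quotientEquivOfIsCompl _ _ D'.isCompl_dom)⟩

omit [CompleteSpace M] in
/-- A decomposition of `F` with `N₂` finitely generated gives a decomposition of `F⋆` with `N₁`
isomorphic to it. -/
theorem Decomposition.exists_adjoint_of_fg' {F : AdjointableMap A M N} (D : Decomposition F)
    (hfg : D.N₂.FG) :
    ∃ D' : Decomposition F.adjoint, Nonempty (D.N₂ ≃ₗ[A] D'.N₁) := by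
  have hc := isCompl_orthogonal D.isClosed_N₂ hfg
  let X := orthogonal D.N₂
  have hX : IsClosed (X : Set N) := isClosed_orthogonal D.N₂
  let π : N →L[A] X := projL hc.symm hX D.isClosed_N₂
  obtain ⟨L, -, -, hFL⟩ := D.exists_leftInverse
  obtain ⟨C, hC, hb⟩ := exists_norm_le L
  obtain ⟨S, hS⟩ := exists_equiv_compression F.adjoint D.isClosed_N₂ hc hC fun x hx => by
    -- Since `x` is orthogonal to `x - F L x`, one has `⟪x, x⟫ = ⟪F⋆ x, L x⟫`, so the bound on `L`
    -- bounds `F⋆` below on `X`.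
    have h0 : inner A x (F.toCLM (L x)) = inner A x x := by
      have := inner_eq_zero_of_mem_orthogonal hx (hFL x)
      rw [CStarModule.inner_sub_right, sub_eq_zero] at this
      exact this.symm
    have h1 : ‖x‖ ^ 2 ≤ ‖F.adjCLM x‖ * (C * ‖x‖) := by
      calc ‖x‖ ^ 2 = ‖inner A (F.adjCLM x) (L x)‖ := by
            rw [CStarModule.norm_sq_eq A, ← h0]
            exact congrArg norm (F.adjoint.inner_adj x (L x)).symm
        _ ≤ ‖F.adjCLM x‖ * ‖L x‖ := norm_inner_le M
        _ ≤ _ := by gcongr; exact hb x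
    rcases eq_or_ne x 0 with rfl | hx0
    · simp
    have := norm_pos_iff.2 hx0
    change ‖x‖ ≤ C * ‖F.adjCLM x‖
    nlinarith
  let D' : Decomposition F.adjoint := .ofComp F.adjoint X.subtypeL
    (S.symm.toContinuousLinearMap ∘L π ∘L F.toCLM) fun x => by
      change S.symm (π (F.toCLM (F.adjCLM x))) = x
      rw [S.symm_apply_eq, hS]
      rfl
  -- Now `D'.M₁` is `X` itself, so `D.N₂` and `D'.N₁` are two complements of `X`.
  have h1 : IsCompl D'.M₁ D.N₂ := by
    convert hc.symm
    exact X.range_subtype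
  exact ⟨D', ⟨(Submodule.quotientEquivOfIsCompl _ _ h1).symm.trans
    (Submodule.quotientEquivOfIsCompl _ _ D'.isCompl_dom)⟩⟩

omit [PartialOrder A] [StarOrderedRing A] [NormedSpace ℂ M] [CStarModule A M] [NormedSpace ℂ N]
  [CStarModule A N] [CompleteSpace M] [CompleteSpace N] in
theorem fg_of_equiv {p : Submodule A M} {q : Submodule A N} (e : p ≃ₗ[A] q) (h : p.FG) : q.FG := by
  rw [← Module.Finite.iff_fg] at h ⊢
  exact Module.Finite.equiv e

theorem mem_mPhiPlus_iff_adjoint_mem_mPhiMinus (F : AdjointableMap A M N) :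
    F ∈ MPhiPlus A M N ↔ F.adjoint ∈ MPhiMinus A N M := by
  constructor
  · rintro ⟨D, h⟩
    obtain ⟨D', h', -⟩ := D.exists_adjoint_of_fg h
    exact ⟨D', h' ▸ h⟩
  · rintro ⟨D, h⟩
    -- `F.adjoint.adjoint` is `F` by definition, so `D'` decomposes `F`.
    obtain ⟨D', ⟨e⟩⟩ := D.exists_adjoint_of_fg' h
    exact ⟨D', fg_of_equiv e h⟩

end Decompositions

/-! ### The index in `K(A)` -/

section IndexTheory
variable {A : Type u} [CStarAlgebra A] [PartialOrder A] [StarOrderedRing A]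
variable {M : Type u} [NormedAddCommGroup M] [NormedSpace ℂ M] [Module A M] [CStarModule A M]
  [CompleteSpace M]
variable {N : Type u} [NormedAddCommGroup N] [NormedSpace ℂ N] [Module A N] [CStarModule A N]
  [CompleteSpace N]

theorem submoduleClass_eq_of_equiv {P : Submodule A M} {Q : Submodule A N}
    (hP : IsClosed (P : Set M)) (hPfg : P.FG) (hQ : IsClosed (Q : Set N)) (hQfg : Q.FG)
    (e : P ≃ₗ[A] Q) : submoduleClass P hP hPfg = submoduleClass Q hQ hQfg := by
  have h : ∀ P Q : FGProjective A, Nonempty (P.carrier ≃ₗ[A] Q.carrier) →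
      KGroup.cls P = KGroup.cls Q := fun P Q h =>
    congrArg Algebra.GrothendieckAddGroup.of (Quotient.sound h)
  exact h _ _ ⟨e⟩

theorem submoduleClass_add_eq_of_equiv {P₁ P₂ : Submodule A M} {Q₁ Q₂ : Submodule A N}
    (hP₁ : IsClosed (P₁ : Set M)) (hP₁fg : P₁.FG) (hP₂ : IsClosed (P₂ : Set M)) (hP₂fg : P₂.FG)
    (hQ₁ : IsClosed (Q₁ : Set N)) (hQ₁fg : Q₁.FG) (hQ₂ : IsClosed (Q₂ : Set N)) (hQ₂fg : Q₂.FG)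
    (e : (Q₁ × P₁) ≃ₗ[A] P₂ × Q₂) :
    submoduleClass Q₁ hQ₁ hQ₁fg + submoduleClass P₁ hP₁ hP₁fg =
      submoduleClass P₂ hP₂ hP₂fg + submoduleClass Q₂ hQ₂ hQ₂fg := by
  have h : ∀ P Q R S : FGProjective A,
      Nonempty ((P.carrier × Q.carrier) ≃ₗ[A] R.carrier × S.carrier) →
      KGroup.cls P + KGroup.cls Q = KGroup.cls R + KGroup.cls S := fun P Q R S h => by
    refine (map_add Algebra.GrothendieckAddGroup.of _ _).symm.trans (Eq.trans ?_ (map_add _ _ _))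
    exact congrArg Algebra.GrothendieckAddGroup.of (Quotient.sound h)
  exact h _ _ _ _ ⟨e⟩

/-- The index does not depend on the decomposition. -/
theorem Decomposition.index_eq {F : AdjointableMap A M N} (D D' : Decomposition F)
    (h₁ : D.N₁.FG) (h₂ : D.N₂.FG) (h₁' : D'.N₁.FG) (h₂' : D'.N₂.FG) :
    D.index h₁ h₂ = D'.index h₁' h₂' := by
  have := projective_submodule D'.N₂ D'.isClosed_N₂ h₂'
  obtain ⟨e⟩ := nonempty_equiv_of_blockDiagonal F.toCLM.toLinearMap D.isCompl_dom D.isCompl_cod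
    D'.isCompl_dom D'.isCompl_cod D.F₁.toLinearEquiv D.apply_M₁ D.apply_N₁
    D'.F₁.toLinearEquiv D'.apply_M₁ D'.apply_N₁
  have h := submoduleClass_add_eq_of_equiv D'.isClosed_N₁ h₁' D.isClosed_N₁ h₁
    D.isClosed_N₂ h₂ D'.isClosed_N₂ h₂' e
  rw [Decomposition.index, Decomposition.index, sub_eq_sub_iff_add_eq_add, ← h, add_comm]

theorem index_eq_of_decomposition {F : AdjointableMap A M N} (hF : F ∈ MPhi A M N)
    (D : Decomposition F) (h₁ : D.N₁.FG) (h₂ : D.N₂.FG) : D.index h₁ h₂ = index F hF :=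
  D.index_eq _ h₁ h₂ _ _

/-- The adjoint of a Fredholm operator is Fredholm, with the opposite index. -/
theorem exists_adjoint_mem_mPhi {F : AdjointableMap A M N} (hF : F ∈ MPhi A M N) :
    ∃ hF' : F.adjoint ∈ MPhi A N M, index F hF = -index F.adjoint hF' := by
  obtain ⟨D, h₁, h₂⟩ := id hF
  -- Only `N₁` needs to be finitely generated to build `D'`; finite generation of `N₂` is carried to
  -- `D'.N₁` by `e`.
  obtain ⟨D', h, ⟨e⟩⟩ := D.exists_adjoint_of_fg h₁
  have h₁' : D'.N₁.FG := fg_of_equiv e h₂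
  have h₂' : D'.N₂.FG := h ▸ h₁
  refine ⟨⟨D', h₁', h₂'⟩, ?_⟩
  refine (index_eq_of_decomposition hF D h₁ h₂).symm.trans
    (Eq.trans ?_ (congrArg Neg.neg (index_eq_of_decomposition _ D' h₁' h₂')))
  rw [
    Decomposition.index, Decomposition.index, neg_sub,
    submoduleClass_eq_of_equiv D.isClosed_N₂ h₂ D'.isClosed_N₁ h₁' e,
    submoduleClass_eq_of_equiv D.isClosed_N₁ h₁ D'.isClosed_N₂ h₂' (LinearEquiv.ofEq _ _ h.symm)]

end IndexTheory
end HilbertMod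

theorem corollary2p11 {A : Type u} [CStarAlgebra A] [PartialOrder A] [StarOrderedRing A] :
    (∀ (M : Type v) [NormedAddCommGroup M] [NormedSpace ℂ M] [Module A M] [CStarModule A M]
        [CompleteSpace M]
        (N : Type w) [NormedAddCommGroup N] [NormedSpace ℂ N] [Module A N] [CStarModule A N]
        [CompleteSpace N] (F : AdjointableMap A M N),
        F ∈ MPhiPlus A M N ↔ F.adjoint ∈ MPhiMinus A N M) ∧
    (∀ (F : AdjointableMap A (StandardModule A) (StandardModule A))
        (hF : F ∈ MPhi A (StandardModule A) (StandardModule A)),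
        (∀ (D : Decomposition F) (h₁ : D.N₁.FG) (h₂ : D.N₂.FG), D.index h₁ h₂ = index F hF) ∧
        ∃ hF' : F.adjoint ∈ MPhi A (StandardModule A) (StandardModule A),
          (∀ (D : Decomposition F.adjoint) (h₁ : D.N₁.FG) (h₂ : D.N₂.FG),
            D.index h₁ h₂ = index F.adjoint hF') ∧
          index F hF = -index F.adjoint hF') := by
  refine ⟨fun M _ _ _ _ _ N _ _ _ _ _ F => mem_mPhiPlus_iff_adjoint_mem_mPhiMinus F,
    fun F hF => ⟨index_eq_of_decomposition hF, ?_⟩⟩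
  obtain ⟨hF', h⟩ := exists_adjoint_mem_mPhi hF
  exact ⟨hF', index_eq_of_decomposition hF', h⟩
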